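/- Let $H$ be a real Hilbert space with inner product $\langle\cdot,\cdot\rangle$, and let $A,B\subseteq H$ be closed convex sets with $A\cap B\neq\emptyset$. For a nonempty closed convex set $C\subseteq H$ let $P_C$ denote the metric projection onto $C$ (so $P_C(x)$ is the unique minimizer of $\|x-y\|$ over $y\in C$), let $N_C(x)=\{v\in H:\langle v,y-x\rangle\le 0\text{ for all }y\in C\}$ be the normal cone, and for $q\in H$ let $C-q=\{c-q:c\in C\}$. For $\alpha,\beta\in(0,1)$ define, with $I$ the identity map of $H$, $$T_{A-q,B-q,\alpha,\beta}=(1-\alpha)I+\alpha(2\beta P_{B-q}-I)(2\beta P_{A-q}-I).$$ Let $\alpha,\beta\in(0,1)$, let $q\in H$ satisfy $q-P_{A\cap B}(q)\in N_A(P_{A\cap B}(q))+N_B(P_{A\cap B}(q))$, let $x_0\in H$ be arbitrary, and for $n=0,1,2,\dots$ let $$y_n=P_A(x_n+q),\qquad x_{n+1}=T_{A-q,B-q,\alpha,\beta}(x_n).$$ Then $(y_n)$ converges weakly to $P_{A\cap B}(q)$, that is, $\langle y_n,z\rangle\to\langle P_{A\cap B}(q),z\rangle$ for every $z\in H$; and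 $P_{A\cap B}(q)$ is the unique solution of the best approximation problem: minimize $\|u-q\|$ subject to $u\in A\cap B$. -/

import Mathlib

open Filter Topology
open scoped Pointwise

namespace AAMR

section

variable {H : Type*} [NormedAddCommGroup H] [InnerProductSpace ℝ H]

/-- `p` solves the best approximation problem: minimize `‖x - y‖` subject to `y ∈ C`. -/
def IsNearestPoint (C : Set H) (x p : H) : Prop :=
  p ∈ C ∧ ∀ y ∈ C, ‖x - p‖ ≤ ‖x - y‖

open Classical in
/-- The metric projection `P_C`: the solution of the best approximation problem. It exists and is
unique when `C` is a nonempty closed convex set of a Hilbert space (see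
`isNearestPoint_iff_eq_metricProj`); the value is `0` when there is no nearest point. -/
noncomputable def metricProj (C : Set H) (x : H) : H :=
  if h : ∃ p, IsNearestPoint C x p then h.choose else 0

/-- The normal cone `N_C(x)`. -/
def normalCone (C : Set H) (x : H) : Set H :=
  {v | ∀ y ∈ C, inner ℝ v (y - x) ≤ 0}

/-- The shifted set `C - q = {c - q : c ∈ C}`. -/
def shift (C : Set H) (q : H) : Set H :=
  {z | ∃ c ∈ C, z = c - q}

/-- The modified reflection `2β P_C - I`. -/
noncomputable def modReflection (C : Set H) (β : ℝ) (x : H) : H :=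
  (2 * β) • metricProj C x - x

/-- The averaged alternating modified reflections operator
`T_{A,B,α,β} = (1 - α) I + α (2β P_B - I)(2β P_A - I)`. -/
noncomputable def aamrOp (A B : Set H) (α β : ℝ) (x : H) : H :=
  (1 - α) • x + α • modReflection B β (modReflection A β x)

/-- Weak convergence `u n ⇀ p` in a real Hilbert space: `⟨u n, z⟩ → ⟨p, z⟩` for all `z`. -/
def WeaklyConvergesTo (u : ℕ → H) (p : H) : Prop :=
  ∀ z : H, Tendsto (fun n => inner ℝ (u n) z) atTop (𝓝 (inner ℝ p z))

/-- On nonempty closed convex sets of a Hilbert space, `metricProj C x` is the unique nearest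
point, so the default value in its definition is not used. -/
theorem isNearestPoint_iff_eq_metricProj [CompleteSpace H] {C : Set H} (hne : C.Nonempty)
    (hcl : IsClosed C) (hcv : Convex ℝ C) (x p : H) :
    IsNearestPoint C x p ↔ p = metricProj C x := by
  have key : ∀ p, IsNearestPoint C x p → ∀ w ∈ C, inner ℝ (x - p) (w - p) ≤ 0 := by
    intro p hp
    rw [← norm_eq_iInf_iff_real_inner_le_zero hcv hp.1]
    have : Nonempty C := hne.to_subtype
    refine le_antisymm (le_ciInf fun w => hp.2 w w.2) ?_
    exact ciInf_le (f := fun w : C => ‖x - w‖)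
      ⟨0, by rintro _ ⟨w, rfl⟩; exact norm_nonneg _⟩ ⟨p, hp.1⟩
  have uniq : ∀ p p', IsNearestPoint C x p → IsNearestPoint C x p' → p = p' := by
    intro p p' hp hp'
    have h1 := key p hp p' hp'.1
    have h2 := key p' hp' p hp.1
    have h3 : inner ℝ (p - p') (p - p') = inner ℝ (x - p) (p' - p) + inner ℝ (x - p') (p - p') := by
      rw [← neg_sub p p', inner_neg_right, ← sub_eq_neg_add, ← inner_sub_left]
      congr 1
      abel
    have h4 : inner ℝ (p - p') (p - p') ≤ 0 := by rw [h3]; linarith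
    exact sub_eq_zero.1 (inner_self_eq_zero (𝕜 := ℝ) |>.1 (le_antisymm h4 real_inner_self_nonneg))
  have ex : ∃ p, IsNearestPoint C x p := by
    obtain ⟨p, hp, h⟩ := exists_norm_eq_iInf_of_complete_convex hne hcl.isComplete hcv x
    refine ⟨p, hp, fun y hy => ?_⟩
    rw [h]
    exact ciInf_le (f := fun w : C => ‖x - w‖)
      ⟨0, by rintro _ ⟨w, rfl⟩; exact norm_nonneg _⟩ ⟨y, hy⟩
  have spec : IsNearestPoint C x (metricProj C x) := by
    rw [metricProj, dif_pos ex]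
    exact ex.choose_spec
  exact ⟨fun h => uniq _ _ h spec, fun h => h ▸ spec⟩

end

end AAMR

/-! Firm nonexpansiveness makes `2βP_C - I` nonexpansive with the surplus `4β(1-β)‖P_C x - P_C y‖²`.
The averaged operator keeps `α` times the surplus of its inner projection `P_A`. If it has a fixed
point `z`, the squared distances from an orbit to `z` decrease by at least a fixed positive multiple
of `‖P_A x_n - P_A z‖²`, so `P_A x_n → P_A z`, even in norm. The normal cone condition supplies such
a `z` whose projection is the wanted point; translation by `q` does the rest. -/

namespace AAMR

section

variable {H : Type*} [NormedAddCommGroup H] [InnerProductSpace ℝ H]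

/-- A point of a convex set satisfying the variational inequality is a nearest point. -/
theorem isNearestPoint_of_mem_normalCone {C : Set H} {x p : H} (hp : p ∈ C)
    (h : x - p ∈ normalCone C p) : IsNearestPoint C x p := by
  refine ⟨hp, fun y hy => ?_⟩
  have h1 : inner ℝ (x - p) (y - p) ≤ 0 := h y hy
  have h2 : ‖x - y‖ ^ 2 = ‖x - p‖ ^ 2 - 2 * inner ℝ (x - p) (y - p) + ‖y - p‖ ^ 2 := by
    rw [← norm_sub_sq_real]
    congr 2
    abel
  nlinarith [norm_nonneg (x - y), norm_nonneg (x - p), sq_nonneg ‖y - p‖]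

/-- A nearest point of a convex set satisfies the variational inequality. -/
theorem IsNearestPoint.mem_normalCone {C : Set H} (hcv : Convex ℝ C) {x p : H}
    (hp : IsNearestPoint C x p) : x - p ∈ normalCone C p := by
  refine (norm_eq_iInf_iff_real_inner_le_zero hcv hp.1).1 ?_
  have : Nonempty C := ⟨⟨p, hp.1⟩⟩
  exact le_antisymm (le_ciInf fun w => hp.2 w w.2)
    (ciInf_le (f := fun w : C => ‖x - w‖)
      ⟨0, by rintro _ ⟨w, rfl⟩; exact norm_nonneg _⟩ ⟨p, hp.1⟩)

theorem smul_mem_normalCone {C : Set H} {p v : H} {t : ℝ} (ht : 0 ≤ t)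
    (hv : v ∈ normalCone C p) : t • v ∈ normalCone C p := by
  intro y hy
  rw [real_inner_smul_left]
  exact mul_nonpos_of_nonneg_of_nonpos ht (hv y hy)

theorem shift_eq_preimage (C : Set H) (q : H) : shift C q = (fun z => z + q) ⁻¹' C := by
  ext z
  constructor
  · rintro ⟨c, hc, rfl⟩
    simpa using hc
  · intro hz
    exact ⟨z + q, hz, by simp⟩

theorem isClosed_shift {C : Set H} (hC : IsClosed C) (q : H) : IsClosed (shift C q) := by
  rw [shift_eq_preimage]
  exact hC.preimage (by fun_prop)

theorem convex_shift {C : Set H} (hC : Convex ℝ C) (q : H) : Convex ℝ (shift C q) := by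
  rw [shift_eq_preimage]
  exact hC.translate_preimage_left q

theorem sub_mem_shift {C : Set H} {c : H} (hc : c ∈ C) (q : H) : c - q ∈ shift C q :=
  ⟨c, hc, rfl⟩

theorem normalCone_shift {C : Set H} {p v : H} (q : H) (hv : v ∈ normalCone C p) :
    v ∈ normalCone (shift C q) (p - q) := by
  rintro _ ⟨c, hc, rfl⟩
  rw [sub_sub_sub_cancel_right]
  exact hv c hc

variable [CompleteSpace H]

theorem isNearestPoint_metricProj {C : Set H} (hne : C.Nonempty) (hcl : IsClosed C)
    (hcv : Convex ℝ C) (x : H) : IsNearestPoint C x (metricProj C x) :=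
  (isNearestPoint_iff_eq_metricProj hne hcl hcv x _).2 rfl

theorem metricProj_eq_of_mem_normalCone {C : Set H} (hcl : IsClosed C) (hcv : Convex ℝ C)
    {x p : H} (hp : p ∈ C) (h : x - p ∈ normalCone C p) : metricProj C x = p :=
  ((isNearestPoint_iff_eq_metricProj ⟨p, hp⟩ hcl hcv x p).1
    (isNearestPoint_of_mem_normalCone hp h)).symm

theorem metricProj_shift {C : Set H} (hne : C.Nonempty) (hcl : IsClosed C) (hcv : Convex ℝ C)
    (q x : H) : metricProj (shift C q) x = metricProj C (x + q) - q := by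
  have h := isNearestPoint_metricProj hne hcl hcv (x + q)
  refine metricProj_eq_of_mem_normalCone (isClosed_shift hcl q) (convex_shift hcv q)
    (sub_mem_shift h.1 q) ?_
  rw [sub_sub_eq_add_sub]
  exact normalCone_shift q (h.mem_normalCone hcv)

/-- The metric projection is firmly nonexpansive. -/
theorem norm_metricProj_sub_sq_le {C : Set H} (hne : C.Nonempty) (hcl : IsClosed C)
    (hcv : Convex ℝ C) (x y : H) :
    ‖metricProj C x - metricProj C y‖ ^ 2 ≤ inner ℝ (metricProj C x - metricProj C y) (x - y) := by
  have hx := isNearestPoint_metricProj hne hcl hcv x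
  have hy := isNearestPoint_metricProj hne hcl hcv y
  have h1 : inner ℝ (x - metricProj C x) (metricProj C y - metricProj C x) ≤ 0 :=
    hx.mem_normalCone hcv _ hy.1
  have h2 : inner ℝ (y - metricProj C y) (metricProj C x - metricProj C y) ≤ 0 :=
    hy.mem_normalCone hcv _ hx.1
  generalize metricProj C x = u at *
  generalize metricProj C y = v at *
  rw [← real_inner_self_eq_norm_sq]
  simp only [inner_sub_left, inner_sub_right] at *
  linarith [real_inner_comm u v, real_inner_comm x u, real_inner_comm x v, real_inner_comm y u,
    real_inner_comm y v]

/-- Modified reflections are nonexpansive, with a gain controlled by the projections. -/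
theorem norm_modReflection_sub_sq_le {C : Set H} (hne : C.Nonempty) (hcl : IsClosed C)
    (hcv : Convex ℝ C) {β : ℝ} (hβ : 0 ≤ β) (x y : H) :
    ‖modReflection C β x - modReflection C β y‖ ^ 2 ≤
      ‖x - y‖ ^ 2 - 4 * β * (1 - β) * ‖metricProj C x - metricProj C y‖ ^ 2 := by
  have h := norm_metricProj_sub_sq_le hne hcl hcv x y
  have h1 : modReflection C β x - modReflection C β y =
      (2 * β) • (metricProj C x - metricProj C y) - (x - y) := by
    simp only [modReflection, smul_sub]
    abel
  rw [h1, norm_sub_sq_real, norm_smul, mul_pow, real_inner_smul_left, Real.norm_eq_abs, sq_abs]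
  -- With `d` the difference of projections, the expansion has `4β²‖d‖² - 4β⟪d, x - y⟫`, and `‖d‖² ≤
  -- ⟪d, x - y⟫`.
  nlinarith [mul_le_mul_of_nonneg_left h hβ]

theorem norm_aamrOp_sub_sq_le {A B : Set H} (hA : A.Nonempty) (hAcl : IsClosed A)
    (hAcv : Convex ℝ A) (hB : B.Nonempty) (hBcl : IsClosed B) (hBcv : Convex ℝ B) {α β : ℝ}
    (hα : α ∈ Set.Ioo (0 : ℝ) 1) (hβ : β ∈ Set.Ioo (0 : ℝ) 1) (x y : H) :
    ‖aamrOp A B α β x - aamrOp A B α β y‖ ^ 2 ≤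
      ‖x - y‖ ^ 2 - 4 * α * β * (1 - β) * ‖metricProj A x - metricProj A y‖ ^ 2 := by
  have h1 := norm_modReflection_sub_sq_le hA hAcl hAcv hβ.1.le x y
  have h2 := norm_modReflection_sub_sq_le hB hBcl hBcv hβ.1.le
    (modReflection A β x) (modReflection A β y)
  -- The surplus from `B` is discarded; only that from `A` is needed.
  have h3 : 0 ≤ 4 * β * (1 - β) * ‖metricProj B (modReflection A β x) -
      metricProj B (modReflection A β y)‖ ^ 2 :=
    mul_nonneg (mul_nonneg (mul_nonneg zero_le_four hβ.1.le) (sub_nonneg.2 hβ.2.le))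
      (sq_nonneg _)
  set u := modReflection B β (modReflection A β x) - modReflection B β (modReflection A β y)
    with hu
  have h4 : aamrOp A B α β x - aamrOp A B α β y = (1 - α) • (x - y) + α • u := by
    simp only [aamrOp, hu, smul_sub]
    abel
  have h5 : ‖(1 - α) • (x - y) + α • u‖ ^ 2 =
      (1 - α) * ‖x - y‖ ^ 2 + α * ‖u‖ ^ 2 - α * (1 - α) * ‖x - y - u‖ ^ 2 := by
    rw [norm_add_sq_real, norm_sub_sq_real (x - y) u, norm_smul, norm_smul, mul_pow, mul_pow,
      real_inner_smul_left, real_inner_smul_right, Real.norm_eq_abs, Real.norm_eq_abs, sq_abs,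
      sq_abs]
    ring
  have h6 : 0 ≤ α * (1 - α) * ‖x - y - u‖ ^ 2 :=
    mul_nonneg (mul_nonneg hα.1.le (sub_nonneg.2 hα.2.le)) (sq_nonneg _)
  have h7 := mul_le_mul_of_nonneg_left (h2.trans (sub_le_self _ h3) |>.trans h1) hα.1.le
  rw [h4, h5]
  linarith

/-- A decomposition `-p = a + b` into normal vectors at `p ∈ A ∩ B` yields a fixed point of the
averaged alternating modified reflections operator whose projection onto `A` is `p`. -/
theorem exists_aamrOp_eq_self {A B : Set H} (hAcl : IsClosed A) (hAcv : Convex ℝ A)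
    (hBcl : IsClosed B) (hBcv : Convex ℝ B) {p : H} (hpA : p ∈ A) (hpB : p ∈ B)
    (hp : -p ∈ normalCone A p + normalCone B p) (α : ℝ) {β : ℝ} (hβ : β ≤ 1) :
    ∃ z, aamrOp A B α β z = z ∧ metricProj A z = p := by
  obtain ⟨a, ha, b, hb, hab⟩ := hp
  have hab' : p = -(a + b) := by rw [← neg_neg p]; exact congrArg Neg.neg hab.symm
  have ht : 0 ≤ 2 * (1 - β) := by linarith
  -- If `P_A z = p` and `P_B (2βp - z) = p`, the two reflections cancel and `z` is fixed. For `z = p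
  -- + t • a`, the vector `2βp - z - p` is `-2(1-β)p - t • a`; since `-p = a + b`, the choice `t =
  -- 2(1-β)` leaves `t • b`, normal to `B`.
  have hPA : metricProj A (p + (2 * (1 - β)) • a) = p := by
    refine metricProj_eq_of_mem_normalCone hAcl hAcv hpA ?_
    rw [add_sub_cancel_left]
    exact smul_mem_normalCone ht ha
  have hPB : metricProj B (modReflection A β (p + (2 * (1 - β)) • a)) = p := by
    refine metricProj_eq_of_mem_normalCone hBcl hBcv hpB ?_
    have : modReflection A β (p + (2 * (1 - β)) • a) - p = (2 * (1 - β)) • b := by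
      rw [modReflection, hPA, hab']
      module
    rw [this]
    exact smul_mem_normalCone ht hb
  refine ⟨p + (2 * (1 - β)) • a, ?_, hPA⟩
  rw [aamrOp, modReflection, hPB, modReflection, hPA]
  module

/-- The decreasing sequence `‖x n - z‖²` converges, so its consecutive differences, which dominate
the projection gaps, vanish. -/
theorem tendsto_metricProj_of_aamrOp_eq_self {A B : Set H} (hA : A.Nonempty)
    (hAcl : IsClosed A) (hAcv : Convex ℝ A) (hB : B.Nonempty) (hBcl : IsClosed B)
    (hBcv : Convex ℝ B) {α β : ℝ} (hα : α ∈ Set.Ioo (0 : ℝ) 1) (hβ : β ∈ Set.Ioo (0 : ℝ) 1)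
    {z : H} (hz : aamrOp A B α β z = z) {x : ℕ → H}
    (hx : ∀ n, x (n + 1) = aamrOp A B α β (x n)) :
    Tendsto (fun n => metricProj A (x n)) atTop (𝓝 (metricProj A z)) := by
  set c := 4 * α * β * (1 - β) with hc
  have hc0 : 0 < c :=
    mul_pos (mul_pos (mul_pos four_pos hα.1) hβ.1) (sub_pos.2 hβ.2)
  have step : ∀ n, c * ‖metricProj A (x n) - metricProj A z‖ ^ 2 ≤
      ‖x n - z‖ ^ 2 - ‖x (n + 1) - z‖ ^ 2 := by
    intro n
    have h := norm_aamrOp_sub_sq_le hA hAcl hAcv hB hBcl hBcv hα hβ (x n) z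
    rw [hz, ← hx n] at h
    linarith
  have hanti : Antitone fun n => ‖x n - z‖ ^ 2 := antitone_nat_of_succ_le fun n => by
    have : 0 ≤ c * ‖metricProj A (x n) - metricProj A z‖ ^ 2 := by positivity
    linarith [step n]
  have hlim := tendsto_atTop_ciInf hanti ⟨0, by rintro _ ⟨n, rfl⟩; positivity⟩
  have hdiff := hlim.sub (hlim.comp (tendsto_add_atTop_nat 1))
  rw [sub_self] at hdiff
  have h1 : Tendsto (fun n => c * ‖metricProj A (x n) - metricProj A z‖ ^ 2) atTop (𝓝 0) :=
    squeeze_zero (fun n => by positivity) step hdiff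
  have h2 : Tendsto (fun n => ‖metricProj A (x n) - metricProj A z‖ ^ 2) atTop (𝓝 0) := by
    simpa [hc0.ne'] using h1.const_mul c⁻¹
  rw [tendsto_iff_norm_sub_tendsto_zero]
  simpa [Real.sqrt_sq] using h2.sqrt

end

end AAMR

theorem theorem3p1 {H : Type*} [NormedAddCommGroup H] [InnerProductSpace ℝ H] [CompleteSpace H]
    (A B : Set H) (hAcl : IsClosed A) (hAcv : Convex ℝ A) (hBcl : IsClosed B) (hBcv : Convex ℝ B)
    (hne : (A ∩ B).Nonempty) (q : H)
    (hq : q - AAMR.metricProj (A ∩ B) q ∈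
      AAMR.normalCone A (AAMR.metricProj (A ∩ B) q) +
        AAMR.normalCone B (AAMR.metricProj (A ∩ B) q))
    (α β : ℝ) (hα : α ∈ Set.Ioo (0 : ℝ) 1) (hβ : β ∈ Set.Ioo (0 : ℝ) 1)
    (x y : ℕ → H)
    (hx : ∀ n, x (n + 1) = AAMR.aamrOp (AAMR.shift A q) (AAMR.shift B q) α β (x n))
    (hy : ∀ n, y n = AAMR.metricProj A (x n + q)) :
    AAMR.WeaklyConvergesTo y (AAMR.metricProj (A ∩ B) q) ∧
      ∀ u : H, AAMR.IsNearestPoint (A ∩ B) q u ↔ u = AAMR.metricProj (A ∩ B) q := by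
  have hcl := hAcl.inter hBcl
  have hcv := hAcv.inter hBcv
  refine ⟨?_, AAMR.isNearestPoint_iff_eq_metricProj hne hcl hcv q⟩
  have hp := (AAMR.isNearestPoint_metricProj hne hcl hcv q).1
  set p := AAMR.metricProj (A ∩ B) q
  have hq' : -(p - q) ∈ AAMR.normalCone (AAMR.shift A q) (p - q) +
      AAMR.normalCone (AAMR.shift B q) (p - q) := by
    rw [neg_sub]
    obtain ⟨a, ha, b, hb, hab⟩ := hq
    exact ⟨a, AAMR.normalCone_shift q ha, b, AAMR.normalCone_shift q hb, hab⟩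
  have hA := AAMR.sub_mem_shift hp.1 q
  have hB := AAMR.sub_mem_shift hp.2 q
  obtain ⟨z, hz, hPz⟩ := AAMR.exists_aamrOp_eq_self (AAMR.isClosed_shift hAcl q)
    (AAMR.convex_shift hAcv q) (AAMR.isClosed_shift hBcl q) (AAMR.convex_shift hBcv q)
    hA hB hq' α hβ.2.le
  have hlim := AAMR.tendsto_metricProj_of_aamrOp_eq_self ⟨_, hA⟩ (AAMR.isClosed_shift hAcl q)
    (AAMR.convex_shift hAcv q) ⟨_, hB⟩ (AAMR.isClosed_shift hBcl q) (AAMR.convex_shift hBcv q)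
    hα hβ hz hx
  -- `P_{A-q}(x_n) = y_n - q`, so adding `q` gives norm convergence of `y`, hence weak convergence.
  have hlimy : Tendsto y atTop (𝓝 p) := by
    have h := hlim.add_const q
    simpa only [hPz, sub_add_cancel, AAMR.metricProj_shift ⟨p, hp.1⟩ hAcl hAcv, ← hy] using h
  exact fun w => hlimy.inner tendsto_const_nhds
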